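/- All sets lie in $\mathbb{R}^n$, and a convex body is a nonempty compact convex set. For a convex body $K$ and a convex body $C$ containing $0$ in its interior, let $$R(K,C)=\inf\{\rho\ge 0:\exists t,\ K\subset t+\rho C\},\qquad r(K,C)=\sup\{\rho\ge 0:\exists t,\ t+\rho C\subset K\},$$ $$D_{\mathrm{MIN}}(K,C)=\max_{s\neq 0}\ \max\{\|x-y\|_C : x,y\in K,\ x-y\in\operatorname{lin}(s)\},$$ where $\|v\|_C=\min\{\lambda\ge 0: v\in\lambda C\}$ is the gauge function of $C$. The convex body $C$ is called Minkowski-centered if $C\subset -s(C)\,C$ and $R(C,-s(C)\,C)=1$, where $s(C)=R(C,-C)$. Let $S\subset\mathbb{R}^2$ be a (nondegenerate) Minkowski-centered triangle. Then the $(r,R,D_{\mathrm{MIN}})$-diagram with respect to $S$, $$f_{\mathrm{MIN}}(\bar{\mathcal C}^2,S)=\left\{\left(\frac{r(K,S)}{R(K,S)},\frac{D_{\mathrm{MIN}}(K,S)}{2R(K,S)}\right): K\subset\mathbb{R}^2\text{ a convex body that is not a single point}\right\},$$ is fully described by the three inequalities $$D_{\mathrm{MIN}}\le 3R,\qquad 2r+R\le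 D_{\mathrm{MIN}},\qquad \frac{D_{\mathrm{MIN}}}{3R}\left(1-\frac{D_{\mathrm{MIN}}}{3R}\right)\le\frac{r}{R}.$$ That is: 1. $f_{\mathrm{MIN}}(\bar{\mathcal C}^2,S)$ is the set of all $(x,y)\in\mathbb{R}^2$ with $x,y\ge 0$ such that $y\le\frac32$, $\ 2x+1\le 2y$ and $\frac{2y}{3}\left(1-\frac{2y}{3}\right)\le x$; 2. for all real numbers $r\ge 0$, $R>0$, $D\ge 0$, there is a convex body $K\subset\mathbb{R}^2$, not a single point, with $r(K,S)=r$, $R(K,S)=R$ and $D_{\mathrm{MIN}}(K,S)=D$ if and only if $D\le 3R$, $\ 2r+R\le D$ and $\frac{D}{3R}\left(1-\frac{D}{3R}\right)\le\frac rR$. -/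

import Mathlib

open scoped Pointwise

noncomputable section

/-- The circumradius `R(K, C)`: the infimum of all `ρ ≥ 0` such that some translate of `ρ C`
contains `K`. -/
def circumradius {n : ℕ} (K C : Set (EuclideanSpace ℝ (Fin n))) : ℝ :=
  sInf {ρ : ℝ | 0 ≤ ρ ∧ ∃ t : EuclideanSpace ℝ (Fin n), K ⊆ t +ᵥ ρ • C}

/-- The inradius `r(K, C)`: the supremum of all `ρ ≥ 0` such that some translate of `ρ C`
is contained in `K`. -/
def inradius {n : ℕ} (K C : Set (EuclideanSpace ℝ (Fin n))) : ℝ :=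
  sSup {ρ : ℝ | 0 ≤ ρ ∧ ∃ t : EuclideanSpace ℝ (Fin n), t +ᵥ ρ • C ⊆ K}

/-- `K` is optimally contained in `C`: `K ⊆ C` and `R(K, C) = 1`. -/
def OptimallyContained {n : ℕ} (K C : Set (EuclideanSpace ℝ (Fin n))) : Prop :=
  K ⊆ C ∧ circumradius K C = 1

/-- The Minkowski asymmetry `s(C) = R(C, -C)`. -/
def minkowskiAsymmetry {n : ℕ} (C : Set (EuclideanSpace ℝ (Fin n))) : ℝ :=
  circumradius C (-C)

/-- `C` is Minkowski-centered: `C` is optimally contained in `-s(C) C`. -/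
def MinkowskiCentered {n : ℕ} (C : Set (EuclideanSpace ℝ (Fin n))) : Prop :=
  OptimallyContained C ((-minkowskiAsymmetry C) • C)

/-- The symmetric `s`-length of `K` for the minimum diameter: the largest value of the gauge
function of `C` on the vectors `x - y`, with `x, y ∈ K`, that lie on the line spanned by `s`. -/
def minLength {n : ℕ} (s : EuclideanSpace ℝ (Fin n)) (K C : Set (EuclideanSpace ℝ (Fin n))) : ℝ :=
  sSup {l : ℝ | ∃ x ∈ K, ∃ y ∈ K, x - y ∈ Submodule.span ℝ {s} ∧ l = gauge C (x - y)}

/-- The minimum diameter `D_MIN(K, C)`: the maximal symmetric `s`-length over all `s ≠ 0`. -/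
def minDiameter {n : ℕ} (K C : Set (EuclideanSpace ℝ (Fin n))) : ℝ :=
  sSup {d : ℝ | ∃ s : EuclideanSpace ℝ (Fin n), s ≠ 0 ∧ d = minLength s K C}

/-- The Blaschke-Santaló diagram of inradius, circumradius and minimum diameter with respect to
the gauge `C`: all points `(r(K, C) / R(K, C), D_MIN(K, C) / (2 R(K, C)))`, where `K` ranges over
the convex bodies that are not single points. -/
def minDiagram {n : ℕ} (C : Set (EuclideanSpace ℝ (Fin n))) : Set (ℝ × ℝ) :=
  {p | ∃ K : ConvexBody (EuclideanSpace ℝ (Fin n)), (K : Set (EuclideanSpace ℝ (Fin n))).Nontrivial ∧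
    p = (inradius K C / circumradius K C, minDiameter K C / (2 * circumradius K C))}

/-- `S` is a (nondegenerate) triangle in the plane. -/
def IsTriangle (S : Set (EuclideanSpace ℝ (Fin 2))) : Prop :=
  ∃ p : Fin 3 → EuclideanSpace ℝ (Fin 2), AffineIndependent ℝ p ∧ S = convexHull ℝ (Set.range p)

end

/-! Everything is read off in barycentric coordinates. A Minkowski-centered triangle has its
centroid at the origin, so `S` is given by three linear forms with zero sum, each at least `-1/3`.
If `m i` is the minimum of the `i`-th form on `K`, then `R = -(m 0 + m 1 + m 2)`. The gauge of `v`
is the maximum of `-3 * form i v`, so `D` is three times the largest width of `K` along a form.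
Rescaled by `R`, the body lies in the unit simplex, touches its three edges, and its largest
coordinate is `d = D / (3R)`.

Hence `d ≤ 1`, and adding the three width bounds at the vertices of an inscribed copy of `S` gives
`2r + R ≤ D`. For the last inequality, the three contact points span a triangle containing a
homothet of `S` of ratio `pqr + (1-p)(1-q)(1-r)`, with `p, q, r` in `[1-d, d]`. This expression is
affine in each variable, so it is smallest at a corner of the cube, where it is at least `d(1-d)`
(`inradius_lower_bound`).

Conversely, two families of polygons realise every admissible pair `(d, ρ)` with `ρ = r / R`, one
for `ρ ≤ d ^ 2` and one for `ρ ≥ d ^ 2`. -/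

/-! ### Barycentric coordinates of a triangle. -/

/-- Linear coordinates adapted to a triangle `S`: the linear parts `form i` of the barycentric
coordinates with respect to the vertices, normalised so that `S = {x | ∀ i, w i ≤ form i x}`. -/
structure TriangleFrame (S : Set (EuclideanSpace ℝ (Fin 2))) (w : Fin 3 → ℝ) where
  vertex : Fin 3 → EuclideanSpace ℝ (Fin 2)
  form : Fin 3 → EuclideanSpace ℝ (Fin 2) →ₗ[ℝ] ℝ
  hull : S = convexHull ℝ (Set.range vertex)
  form_vertex : ∀ i j, form i (vertex j) = (if i = j then 1 else 0) + w i
  form_inj : ∀ x y, (∀ i, form i x = form i y) → x = y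
  mem_iff : ∀ x, x ∈ S ↔ ∀ i, w i ≤ form i x
  sum_form : ∀ x, form 0 x + form 1 x + form 2 x = 0
  sum_offset : w 0 + w 1 + w 2 = -1

theorem IsTriangle.exists_frame {S : Set (EuclideanSpace ℝ (Fin 2))} (hS : IsTriangle S) :
    ∃ w, Nonempty (TriangleFrame S w) := by
  obtain ⟨p, hp, rfl⟩ := hS
  have htop : affineSpan ℝ (Set.range p) = ⊤ := by
    rw [hp.affineSpan_eq_top_iff_card_eq_finrank_add_one]
    simp
  let b : AffineBasis (Fin 3) ℝ (EuclideanSpace ℝ (Fin 2)) := ⟨p, hp, htop⟩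
  have hlin : ∀ i x, (b.coord i).linear x = b.coord i x - b.coord i 0 := by
    intro i x
    have h := (b.coord i).linearMap_vsub x 0
    simpa using h
  have hsum : ∀ x, b.coord 0 x + b.coord 1 x + b.coord 2 x = 1 := by
    intro x
    have h := b.sum_coord_apply_eq_one x
    rwa [Fin.sum_univ_three] at h
  refine ⟨fun i => -b.coord i 0, ⟨⟨p, fun i => (b.coord i).linear, rfl, ?_, ?_, ?_, ?_, ?_⟩⟩⟩
  · intro i j
    rw [hlin]
    have : b.coord i (p j) = if i = j then 1 else 0 := b.coord_apply i j
    rw [this]; ring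
  · intro x y h
    refine b.ext_elem fun i => ?_
    have := h i
    rw [hlin, hlin] at this
    linarith
  · intro x
    have : convexHull ℝ (Set.range p) = {x | ∀ i, 0 ≤ b.coord i x} :=
      b.convexHull_eq_nonneg_coord
    rw [this]
    refine forall_congr' fun i => ?_
    rw [hlin]
    constructor <;> intro h <;> linarith
  · intro x
    simp only [hlin]
    linarith [hsum x, hsum 0]
  · linarith [hsum 0]

namespace TriangleFrame

variable {S : Set (EuclideanSpace ℝ (Fin 2))} {w : Fin 3 → ℝ}

theorem exists_form_eq (F : TriangleFrame S w) (v : Fin 3 → ℝ) (hv : v 0 + v 1 + v 2 = 0) :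
    ∃ x, ∀ i, F.form i x = v i := by
  refine ⟨∑ j, v j • F.vertex j, fun i => ?_⟩
  have h : F.form i (∑ j, v j • F.vertex j) = v i + w i * (v 0 + v 1 + v 2) := by
    simp only [Fin.sum_univ_three, map_add, map_smul, F.form_vertex, smul_eq_mul]
    fin_cases i <;> simp <;> ring
  rw [h, hv]; ring

theorem convex (F : TriangleFrame S w) : Convex ℝ S := by
  rw [F.hull]; exact convex_convexHull ℝ _

theorem isCompact (F : TriangleFrame S w) : IsCompact S := by
  rw [F.hull]; exact (Set.finite_range _).isCompact_convexHull ℝ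

theorem vertex_mem (F : TriangleFrame S w) (i : Fin 3) : F.vertex i ∈ S := by
  exact F.hull.ge (subset_convexHull ℝ _ ⟨i, rfl⟩)

theorem homothet_subset_iff (F : TriangleFrame S w) {K : Set (EuclideanSpace ℝ (Fin 2))}
    (hK : Convex ℝ K) (t : EuclideanSpace ℝ (Fin 2)) (ρ : ℝ) :
    t +ᵥ ρ • S ⊆ K ↔ ∀ i, t + ρ • F.vertex i ∈ K := by
  constructor
  · intro h i
    exact h (Set.vadd_mem_vadd_set (Set.smul_mem_smul_set (F.vertex_mem i)))
  · intro h
    have hpre : Convex ℝ ((fun x => t + ρ • x) ⁻¹' K) := by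
      have := hK.affine_preimage
        ((AffineMap.const ℝ (EuclideanSpace ℝ (Fin 2)) t) +
          (ρ • LinearMap.id : EuclideanSpace ℝ (Fin 2) →ₗ[ℝ] _).toAffineMap)
      exact this
    have hsub : S ⊆ (fun x => t + ρ • x) ⁻¹' K := by
      rw [F.hull]
      refine convexHull_min ?_ hpre
      rintro _ ⟨i, rfl⟩
      exact h i
    rintro _ ⟨_, ⟨x, hx, rfl⟩, rfl⟩
    exact hsub hx

end TriangleFrame

/-! ### Circumradius, Minkowski asymmetry and centering. -/

/-- The circumradius with respect to a triangle `{x | ∀ i, w i ≤ a i x}` in terms of the minima of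
the linear forms `a i`. -/
theorem circumradius_eq_of_isLeast {K C : Set (EuclideanSpace ℝ (Fin 2))}
    {a : Fin 3 → EuclideanSpace ℝ (Fin 2) →ₗ[ℝ] ℝ} {w m : Fin 3 → ℝ}
    (hsurj : ∀ v : Fin 3 → ℝ, v 0 + v 1 + v 2 = 0 → ∃ x, ∀ i, a i x = v i)
    (hsum : ∀ x, a 0 x + a 1 x + a 2 x = 0) (hw : w 0 + w 1 + w 2 = -1)
    (hinj : ∀ x y, (∀ i, a i x = a i y) → x = y)
    (hC : ∀ x, x ∈ C ↔ ∀ i, w i ≤ a i x)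
    (hm : ∀ i, IsLeast (a i '' K) (m i)) :
    circumradius K C = -(m 0 + m 1 + m 2) := by
  have hne : K.Nonempty := by
    obtain ⟨x, hx, -⟩ := (hm 0).1
    exact ⟨x, hx⟩
  have hlow : ∀ i, ∀ x ∈ K, m i ≤ a i x := fun i x hx => (hm i).2 ⟨x, hx, rfl⟩
  obtain ⟨x₀, hx₀⟩ := hne
  have hnn : 0 ≤ -(m 0 + m 1 + m 2) := by
    linarith [hlow 0 x₀ hx₀, hlow 1 x₀ hx₀, hlow 2 x₀ hx₀, hsum x₀]
  have hCne : ∃ z, ∀ i, a i z = w i + 1 / 3 := hsurj (fun i => w i + 1 / 3) (by linarith)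
  obtain ⟨z, hz⟩ := hCne
  have hzC : z ∈ C := (hC z).2 fun i => by rw [hz]; linarith
  suffices h : {ρ : ℝ | 0 ≤ ρ ∧ ∃ t : EuclideanSpace ℝ (Fin 2), K ⊆ t +ᵥ ρ • C}
      = Set.Ici (-(m 0 + m 1 + m 2)) by
    rw [circumradius, h, csInf_Ici]
  ext ρ
  constructor
  · rintro ⟨hρ, t, ht⟩
    have key : ∀ i, a i t + ρ * w i ≤ m i := by
      intro i
      obtain ⟨x, hx, hxm⟩ := (hm i).1
      obtain ⟨_, ⟨y, hy, rfl⟩, rfl⟩ := ht hx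
      have h1 := mul_le_mul_of_nonneg_left ((hC y).1 hy i) hρ
      simp only [vadd_eq_add, map_add, map_smul, smul_eq_mul] at hxm
      linarith
    have e : ρ * w 0 + ρ * w 1 + ρ * w 2 = -ρ := by
      rw [← mul_add, ← mul_add, hw]; ring
    simp only [Set.mem_Ici]
    linarith [key 0, key 1, key 2, hsum t]
  · intro hρ
    simp only [Set.mem_Ici] at hρ
    have hρ0 : 0 ≤ ρ := hnn.trans hρ
    refine ⟨hρ0, ?_⟩
    -- The slack of `ρ` over the minimal ratio is shared equally among the three edges.
    set e := (ρ + (m 0 + m 1 + m 2)) / 3 with he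
    have hs : ρ * w 0 + ρ * w 1 + ρ * w 2 = -ρ := by
      rw [← mul_add, ← mul_add, hw]; ring
    obtain ⟨t, ht⟩ := hsurj (fun i => m i - ρ * w i - e) (by simp only [he]; linarith)
    refine ⟨t, fun x hx => ?_⟩
    -- For `ρ = 0` one cannot rescale by `ρ⁻¹`; the slack vanishes and `K` is a single point.
    rcases hρ0.eq_or_lt with h0 | hpos
    · subst h0
      refine ⟨0, ⟨z, hzC, by simp⟩, ?_⟩
      have he0 : 0 ≤ e := by rw [he]; linarith
      have h := fun i => hlow i x hx
      have h3 := hsum x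
      simp only [vadd_eq_add, add_zero]
      refine hinj _ _ fun i => ?_
      rw [ht]
      have := h 0; have := h 1; have := h 2
      fin_cases i <;> simp <;> linarith
    · refine ⟨x - t, ⟨ρ⁻¹ • (x - t), ?_, by simp [smul_smul, hpos.ne']⟩, by simp⟩
      refine (hC _).2 fun i => ?_
      have he0 : 0 ≤ e := by rw [he]; linarith
      rw [map_smul, map_sub, ht, smul_eq_mul, inv_mul_eq_div, le_div_iff₀ hpos]
      linarith [hlow i x hx]

/-- The Minkowski asymmetry of a triangle is `2`. -/
theorem TriangleFrame.minkowskiAsymmetry_eq {S : Set (EuclideanSpace ℝ (Fin 2))} {w : Fin 3 → ℝ}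
    (F : TriangleFrame S w) : minkowskiAsymmetry S = 2 := by
  have h := circumradius_eq_of_isLeast (K := S) (C := -S) (a := fun i => -F.form i) (w := w)
    (m := fun i => -(1 + w i)) ?_ ?_ F.sum_offset ?_ ?_ ?_
  · rw [minkowskiAsymmetry, h]
    linarith [F.sum_offset]
  · intro v hv
    obtain ⟨x, hx⟩ := F.exists_form_eq (fun i => -v i) (by linarith)
    exact ⟨x, fun i => by simp [hx]⟩
  · intro x
    simp only [LinearMap.neg_apply]
    linarith [F.sum_form x]
  · intro x y hxy
    exact F.form_inj x y fun i => by simpa using hxy i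
  · intro x
    rw [Set.mem_neg, F.mem_iff]
    simp
  · intro i
    refine ⟨⟨F.vertex i, F.vertex_mem i, by simp [F.form_vertex]⟩, ?_⟩
    rintro _ ⟨x, hx, rfl⟩
    have h := (F.mem_iff x).1 hx
    have := h 0; have := h 1; have := h 2
    have := F.sum_form x
    have := F.sum_offset
    fin_cases i <;> simp <;> linarith

/-- A Minkowski-centered triangle has its centroid at the origin. -/
theorem MinkowskiCentered.exists_frame {S : Set (EuclideanSpace ℝ (Fin 2))}
    (hS : IsTriangle S) (hcent : MinkowskiCentered S) :
    Nonempty (TriangleFrame S fun _ => -(1 / 3)) := by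
  obtain ⟨w, ⟨F⟩⟩ := hS.exists_frame
  suffices h : w = fun _ => -(1 / 3) by exact h ▸ ⟨F⟩
  -- Since vertex `i` lies in `-2S`, `1 + w i ≤ -2 * w i`. The offsets sum to `-1`, so all three
  -- bounds are equalities.
  have key : ∀ i, w i ≤ -(1 / 3) := by
    intro i
    obtain ⟨y, hy, hyp⟩ := hcent.1 (F.vertex_mem i)
    have h1 := (F.mem_iff y).1 hy i
    have h2 := congrArg (F.form i) hyp
    simp only [F.minkowskiAsymmetry_eq, map_smul, smul_eq_mul, F.form_vertex, if_true] at h2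
    linarith
  funext i
  have := key 0; have := key 1; have := key 2; have := F.sum_offset
  refine le_antisymm (key i) ?_
  fin_cases i <;> simp <;> linarith

/-- A triangle with centroid at the origin, with its barycentric coordinate forms. -/
abbrev CenteredFrame (S : Set (EuclideanSpace ℝ (Fin 2))) := TriangleFrame S fun _ => -(1 / 3)

/-! ### The gauge function of a centered triangle. -/

namespace CenteredFrame

variable {S : Set (EuclideanSpace ℝ (Fin 2))}

theorem form_le_gauge (F : CenteredFrame S) (i : Fin 3) (v : EuclideanSpace ℝ (Fin 2)) :
    -3 * F.form i v ≤ gauge S v := by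
  refine le_csInf ?_ ?_
  · set c := 1 + 3 * (|F.form 0 v| + |F.form 1 v| + |F.form 2 v|) with hc
    have h0 := abs_nonneg (F.form 0 v)
    have h1 := abs_nonneg (F.form 1 v)
    have h2 := abs_nonneg (F.form 2 v)
    have hpos : 0 < c := by linarith
    refine ⟨c, hpos, c⁻¹ • v, (F.mem_iff _).2 fun j => ?_, by simp [smul_smul, hpos.ne']⟩
    have hj : -|F.form j v| ≤ F.form j v := neg_abs_le _
    rw [map_smul, smul_eq_mul, inv_mul_eq_div, le_div_iff₀ hpos]
    fin_cases j <;> simp at hj ⊢ <;> linarith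
  · rintro r ⟨hr, y, hy, rfl⟩
    have h := mul_le_mul_of_nonneg_left ((F.mem_iff y).1 hy i) hr.le
    simp only [map_smul, smul_eq_mul]
    linarith

theorem gauge_le (F : CenteredFrame S) {v : EuclideanSpace ℝ (Fin 2)} {c : ℝ}
    (hc : 0 ≤ c) (h : ∀ i, -3 * F.form i v ≤ c) : gauge S v ≤ c := by
  refine le_of_forall_pos_le_add fun ε hε => ?_
  have hpos : 0 < c + ε := by linarith
  refine gauge_le_of_mem hpos.le ⟨(c + ε)⁻¹ • v, (F.mem_iff _).2 fun i => ?_,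
    by simp [smul_smul, hpos.ne']⟩
  rw [map_smul, smul_eq_mul, inv_mul_eq_div, le_div_iff₀ hpos]
  linarith [h i]

theorem circumradius_eq (F : CenteredFrame S) {K : Set (EuclideanSpace ℝ (Fin 2))}
    {m : Fin 3 → ℝ} (hm : ∀ i, IsLeast (F.form i '' K) (m i)) :
    circumradius K S = -(m 0 + m 1 + m 2) :=
  circumradius_eq_of_isLeast F.exists_form_eq F.sum_form F.sum_offset F.form_inj F.mem_iff hm

end CenteredFrame

/-! ### The minimum diameter as a supremum of gauge distances. -/

section MinDiameter

variable {K C : Set (EuclideanSpace ℝ (Fin 2))} {M : ℝ}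

theorem minLength_le (hM : 0 ≤ M) (h : ∀ x ∈ K, ∀ y ∈ K, gauge C (x - y) ≤ M)
    (s : EuclideanSpace ℝ (Fin 2)) : minLength s K C ≤ M := by
  refine Real.sSup_le ?_ hM
  rintro _ ⟨x, hx, y, hy, -, rfl⟩
  exact h x hx y hy

theorem minDiameter_le (hM : 0 ≤ M) (h : ∀ x ∈ K, ∀ y ∈ K, gauge C (x - y) ≤ M) :
    minDiameter K C ≤ M := by
  refine Real.sSup_le ?_ hM
  rintro _ ⟨s, -, rfl⟩
  exact minLength_le hM h s

/-- The uniform bound `M` is essential: a real `sSup` of an unbounded set is `0`. -/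
theorem gauge_le_minDiameter (hM : 0 ≤ M) (h : ∀ x ∈ K, ∀ y ∈ K, gauge C (x - y) ≤ M)
    {x y : EuclideanSpace ℝ (Fin 2)} (hx : x ∈ K) (hy : y ∈ K) :
    gauge C (x - y) ≤ minDiameter K C := by
  by_cases hxy : x - y = 0
  · rw [hxy, gauge_zero]
    refine Real.sSup_nonneg ?_
    rintro _ ⟨s, -, rfl⟩
    refine Real.sSup_nonneg ?_
    rintro _ ⟨x, -, y, -, -, rfl⟩
    exact gauge_nonneg _
  · calc gauge C (x - y) ≤ minLength (x - y) K C := by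
          refine le_csSup ⟨M, ?_⟩ ⟨x, hx, y, hy, Submodule.mem_span_singleton_self _, rfl⟩
          rintro _ ⟨x, hx, y, hy, -, rfl⟩
          exact h x hx y hy
      _ ≤ minDiameter K C := by
          refine le_csSup ⟨M, ?_⟩ ⟨x - y, hxy, rfl⟩
          rintro _ ⟨s, -, rfl⟩
          exact minLength_le hM h s

end MinDiameter

/-! ### A trilinear inequality on a cube. -/

/-- The triangle with one vertex on each edge of a unit simplex contains a homothet of the simplex
of ratio `p q r + (1 - p) (1 - q) (1 - r)`; here is the lower bound for that ratio. -/
theorem mul_one_sub_le_inscribed_ratio {d p q r : ℝ} (hp : p ≤ d) (hp' : 1 - p ≤ d)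
    (hq : q ≤ d) (hq' : 1 - q ≤ d) (hr : r ≤ d) (hr' : 1 - r ≤ d) :
    d * (1 - d) ≤ p * q * r + (1 - p) * (1 - q) * (1 - r) := by
  -- An affine function that is nonnegative at `d` and `1 - d` is nonnegative between them; it is
  -- applied to one variable at a time.
  have affine_ineq : ∀ {A B x : ℝ}, x ≤ d → 1 - x ≤ d → 0 ≤ A * d + B * (1 - d) →
      0 ≤ A * (1 - d) + B * d → 0 ≤ A * x + B * (1 - x) := by
    intro A B x h1 h2 hA hB
    rcases eq_or_ne d (1 / 2) with hd | hd
    · have : x = 1 / 2 := by linarith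
      subst this; subst hd; linarith
    · have hd' : 0 < 2 * d - 1 := by
        have : (1 : ℝ) / 2 ≤ d := by linarith
        have := lt_of_le_of_ne this hd.symm
        linarith
      have e : (2 * d - 1) * (A * x + B * (1 - x)) =
          (x - (1 - d)) * (A * d + B * (1 - d)) + (d - x) * (A * (1 - d) + B * d) := by ring
      have := mul_nonneg (show 0 ≤ x - (1 - d) by linarith) hA
      have := mul_nonneg (show 0 ≤ d - x by linarith) hB
      refine nonneg_of_mul_nonneg_right ?_ hd'
      linarith
  -- The corner values are `d(1-d)` and `1 - 3d(1-d)`; they differ by `(2d-1)^2`.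
  have corner : ∀ {x y z : ℝ}, (x = d ∨ x = 1 - d) → (y = d ∨ y = 1 - d) →
      (z = d ∨ z = 1 - d) → 0 ≤ x * y * z + (1 - x) * (1 - y) * (1 - z) - d * (1 - d) := by
    have h := sq_nonneg (2 * d - 1)
    rintro x y z (rfl | rfl) (rfl | rfl) (rfl | rfl) <;> nlinarith
  have h1 : ∀ {x y z : ℝ}, (x = d ∨ x = 1 - d) → (y = d ∨ y = 1 - d) → z ≤ d → 1 - z ≤ d →
      0 ≤ x * y * z + (1 - x) * (1 - y) * (1 - z) - d * (1 - d) := by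
    intro x y z hx hy hz hz'
    have := affine_ineq (A := x * y - d * (1 - d)) (B := (1 - x) * (1 - y) - d * (1 - d)) hz hz'
      (by linarith [corner hx hy (Or.inl rfl)]) (by linarith [corner hx hy (Or.inr rfl)])
    linarith
  have h2 : ∀ {x y z : ℝ}, (x = d ∨ x = 1 - d) → y ≤ d → 1 - y ≤ d → z ≤ d → 1 - z ≤ d →
      0 ≤ x * y * z + (1 - x) * (1 - y) * (1 - z) - d * (1 - d) := by
    intro x y z hx hy hy' hz hz'
    have := affine_ineq (A := x * z - d * (1 - d)) (B := (1 - x) * (1 - z) - d * (1 - d)) hy hy'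
      (by linarith [h1 hx (Or.inl rfl) hz hz']) (by linarith [h1 hx (Or.inr rfl) hz hz'])
    linarith
  have := affine_ineq (A := q * r - d * (1 - d)) (B := (1 - q) * (1 - r) - d * (1 - d)) hp hp'
    (by linarith [h2 (Or.inl rfl) hq hq' hr hr']) (by linarith [h2 (Or.inr rfl) hq hq' hr hr'])
  linarith

/-! ### The three inequalities for an arbitrary body. -/

namespace CenteredFrame

variable {S : Set (EuclideanSpace ℝ (Fin 2))}

theorem gauge_sub_le (F : CenteredFrame S) {K : Set (EuclideanSpace ℝ (Fin 2))} {m : Fin 3 → ℝ}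
    (hm : ∀ i, IsLeast (F.form i '' K) (m i)) :
    ∀ x ∈ K, ∀ y ∈ K, gauge S (x - y) ≤ 3 * circumradius K S := by
  intro x hx y hy
  have hlow : ∀ i, ∀ x ∈ K, m i ≤ F.form i x := fun i x hx => (hm i).2 ⟨x, hx, rfl⟩
  have hx' := fun i => hlow i x hx
  have hy' := fun i => hlow i y hy
  have sx := F.sum_form x
  have sy := F.sum_form y
  have := hx' 0; have := hx' 1; have := hx' 2
  have := hy' 0; have := hy' 1; have := hy' 2
  rw [F.circumradius_eq hm]
  refine F.gauge_le (by linarith) fun i => ?_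
  rw [map_sub]
  fin_cases i <;> simp <;> linarith

theorem minDiameter_le_three_mul_circumradius (F : CenteredFrame S)
    {K : Set (EuclideanSpace ℝ (Fin 2))} {m : Fin 3 → ℝ}
    (hm : ∀ i, IsLeast (F.form i '' K) (m i)) :
    minDiameter K S ≤ 3 * circumradius K S := by
  obtain ⟨x, hx, -⟩ := (hm 0).1
  exact minDiameter_le ((gauge_nonneg _).trans (F.gauge_sub_le hm x hx x hx)) (F.gauge_sub_le hm)

theorem width_le_minDiameter (F : CenteredFrame S)
    {K : Set (EuclideanSpace ℝ (Fin 2))} {m : Fin 3 → ℝ}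
    (hm : ∀ i, IsLeast (F.form i '' K) (m i)) (i : Fin 3) {y : EuclideanSpace ℝ (Fin 2)}
    (hy : y ∈ K) : 3 * (F.form i y - m i) ≤ minDiameter K S := by
  obtain ⟨x, hx, hxm⟩ := (hm i).1
  have h := F.gauge_sub_le hm
  have h1 := gauge_le_minDiameter ((gauge_nonneg _).trans (h x hx x hx)) h hx hy
  have h2 := F.form_le_gauge i (x - y)
  rw [map_sub, hxm] at h2
  linarith

theorem two_mul_add_circumradius_le (F : CenteredFrame S)
    {K : Set (EuclideanSpace ℝ (Fin 2))} {m : Fin 3 → ℝ} (hK : Convex ℝ K)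
    (hm : ∀ i, IsLeast (F.form i '' K) (m i)) {ρ : ℝ} {t : EuclideanSpace ℝ (Fin 2)}
    (ht : t +ᵥ ρ • S ⊆ K) : 2 * ρ + circumradius K S ≤ minDiameter K S := by
  rw [F.homothet_subset_iff hK] at ht
  have h : ∀ i, 3 * (F.form i t + ρ * (2 / 3) - m i) ≤ minDiameter K S := by
    intro i
    have h := F.width_le_minDiameter hm i (ht i)
    rw [map_add, map_smul, F.form_vertex, if_pos rfl, smul_eq_mul] at h
    linarith
  rw [F.circumradius_eq hm]
  linarith [h 0, h 1, h 2, F.sum_form t]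

theorem inradius_set_bddAbove (F : CenteredFrame S)
    {K : Set (EuclideanSpace ℝ (Fin 2))} {m : Fin 3 → ℝ} (hK : Convex ℝ K)
    (hm : ∀ i, IsLeast (F.form i '' K) (m i)) :
    BddAbove {ρ : ℝ | 0 ≤ ρ ∧ ∃ t : EuclideanSpace ℝ (Fin 2), t +ᵥ ρ • S ⊆ K} := by
  refine ⟨(minDiameter K S - circumradius K S) / 2, ?_⟩
  rintro ρ ⟨-, t, ht⟩
  linarith [F.two_mul_add_circumradius_le hK hm ht]

theorem le_inradius (F : CenteredFrame S)
    {K : Set (EuclideanSpace ℝ (Fin 2))} {m : Fin 3 → ℝ} (hK : Convex ℝ K)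
    (hm : ∀ i, IsLeast (F.form i '' K) (m i)) {ρ : ℝ} (hρ : 0 ≤ ρ)
    {t : EuclideanSpace ℝ (Fin 2)} (ht : ∀ i, t + ρ • F.vertex i ∈ K) : ρ ≤ inradius K S :=
  le_csSup (F.inradius_set_bddAbove hK hm) ⟨hρ, t, (F.homothet_subset_iff hK t ρ).2 ht⟩

theorem two_mul_inradius_add_circumradius_le (F : CenteredFrame S)
    {K : Set (EuclideanSpace ℝ (Fin 2))} {m : Fin 3 → ℝ} (hK : Convex ℝ K)
    (hm : ∀ i, IsLeast (F.form i '' K) (m i)) :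
    2 * inradius K S + circumradius K S ≤ minDiameter K S := by
  suffices h : inradius K S ≤ (minDiameter K S - circumradius K S) / 2 by linarith
  obtain ⟨x, hx, -⟩ := (hm 0).1
  refine csSup_le ⟨0, le_rfl, x, ?_⟩ ?_
  · rw [F.homothet_subset_iff hK]
    simpa using hx
  · rintro ρ ⟨-, t, ht⟩
    linarith [F.two_mul_add_circumradius_le hK hm ht]

theorem circumradius_pos (F : CenteredFrame S)
    {K : Set (EuclideanSpace ℝ (Fin 2))} {m : Fin 3 → ℝ} (hK : K.Nontrivial)
    (hm : ∀ i, IsLeast (F.form i '' K) (m i)) : 0 < circumradius K S := by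
  by_contra! hR
  obtain ⟨x, hx, y, hy, hxy⟩ := hK
  refine hxy (F.form_inj x y fun i => ?_)
  have h1 := F.minDiameter_le_three_mul_circumradius hm
  have key : ∀ z ∈ K, F.form i z = m i := fun z hz =>
    le_antisymm (by linarith [F.width_le_minDiameter hm i hz]) ((hm i).2 ⟨z, hz, rfl⟩)
  rw [key x hx, key y hy]

theorem inradius_lower_bound (F : CenteredFrame S)
    {K : Set (EuclideanSpace ℝ (Fin 2))} {m : Fin 3 → ℝ} (hK : Convex ℝ K)
    (hm : ∀ i, IsLeast (F.form i '' K) (m i)) (hR : 0 < circumradius K S) :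
    minDiameter K S / (3 * circumradius K S) * (1 - minDiameter K S / (3 * circumradius K S)) ≤
      inradius K S / circumradius K S := by
  set R := circumradius K S with hRdef
  set d := minDiameter K S / (3 * R) with hd
  have hR' : R = -(m 0 + m 1 + m 2) := F.circumradius_eq hm
  have hlow : ∀ i, ∀ x ∈ K, m i ≤ F.form i x := fun i x hx => (hm i).2 ⟨x, hx, rfl⟩
  have hup : ∀ i, ∀ x ∈ K, (F.form i x - m i) / R ≤ d := by
    intro i x hx
    rw [hd, div_le_div_iff₀ hR (by positivity)]
    nlinarith [F.width_le_minDiameter hm i hx]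
  have hsum : ∀ x, (F.form 0 x - m 0) / R + (F.form 1 x - m 1) / R + (F.form 2 x - m 2) / R = 1 := by
    intro x
    rw [← add_div, ← add_div, div_eq_one_iff_eq hR.ne']
    linarith [F.sum_form x]
  have hform : ∀ i x, F.form i x = m i + R * ((F.form i x - m i) / R) := by
    intro i x
    field_simp
    ring
  -- `x i` is a point of `K` on the `i`-th edge of the circumscribed triangle.
  choose x hx hxm using fun i => (hm i).1
  set p := (F.form 1 (x 0) - m 1) / R with hp
  set q := (F.form 2 (x 1) - m 2) / R with hq
  set r := (F.form 0 (x 2) - m 0) / R with hr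
  have hp2 : (F.form 2 (x 0) - m 2) / R = 1 - p := by
    have := hsum (x 0); rw [hxm 0, sub_self, zero_div] at this; linarith
  have hq2 : (F.form 0 (x 1) - m 0) / R = 1 - q := by
    have := hsum (x 1); rw [hxm 1, sub_self, zero_div] at this; linarith
  have hr2 : (F.form 1 (x 2) - m 1) / R = 1 - r := by
    have := hsum (x 2); rw [hxm 2, sub_self, zero_div] at this; linarith
  have nn : ∀ i j, 0 ≤ (F.form i (x j) - m i) / R := fun i j =>
    div_nonneg (by linarith [hlow i _ (hx j)]) hR.le
  have p0 : 0 ≤ p := nn 1 0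
  have p1 : 0 ≤ 1 - p := hp2 ▸ nn 2 0
  have q0 : 0 ≤ q := nn 2 1
  have q1 : 0 ≤ 1 - q := hq2 ▸ nn 0 1
  have r0 : 0 ≤ r := nn 0 2
  have r1 : 0 ≤ 1 - r := hr2 ▸ nn 1 2
  have e00 : F.form 0 (x 0) = m 0 := hxm 0
  have e10 : F.form 1 (x 0) = m 1 + R * p := hform 1 (x 0)
  have e20 : F.form 2 (x 0) = m 2 + R * (1 - p) := hp2 ▸ hform 2 (x 0)
  have e11 : F.form 1 (x 1) = m 1 := hxm 1
  have e21 : F.form 2 (x 1) = m 2 + R * q := hform 2 (x 1)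
  have e01 : F.form 0 (x 1) = m 0 + R * (1 - q) := hq2 ▸ hform 0 (x 1)
  have e22 : F.form 2 (x 2) = m 2 := hxm 2
  have e02 : F.form 0 (x 2) = m 0 + R * r := hform 0 (x 2)
  have e12 : F.form 1 (x 2) = m 1 + R * (1 - r) := hr2 ▸ hform 1 (x 2)
  set Q := p * q * r + (1 - p) * (1 - q) * (1 - r) with hQ
  have hQ0 : 0 ≤ Q := by positivity
  have hQd : d * (1 - d) ≤ Q := mul_one_sub_le_inscribed_ratio (hup 1 _ (hx 0))
    (hp2 ▸ hup 2 _ (hx 0)) (hup 2 _ (hx 1)) (hq2 ▸ hup 0 _ (hx 1)) (hup 0 _ (hx 2))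
    (hr2 ▸ hup 1 _ (hx 2))
  -- Each edge of the contact triangle is divided using the coordinates of the opposite contact
  -- point, exchanged. The three division points are the vertices of a homothet of `S` of ratio `R *
  -- Q`.
  have hy0 : (1 - p) • x 1 + p • x 2 ∈ K := hK (hx 1) (hx 2) p1 p0 (by ring)
  have hy1 : (1 - q) • x 2 + q • x 0 ∈ K := hK (hx 2) (hx 0) q1 q0 (by ring)
  have hy2 : (1 - r) • x 0 + r • x 1 ∈ K := hK (hx 0) (hx 1) r1 r0 (by ring)
  have hr' : R * Q ≤ inradius K S := by
    refine F.le_inradius hK hm (t := (1 - p) • x 1 + p • x 2 - (R * Q) • F.vertex 0)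
      (by positivity) fun i => ?_
    match i with
    | 0 => rwa [sub_add_cancel]
    | 1 =>
      convert hy1 using 1
      refine F.form_inj _ _ fun j => ?_
      match j with
      | 0 => simp [F.form_vertex, e00, e01, e02, hQ]; ring
      | 1 => simp [F.form_vertex, e10, e11, e12, hQ]; ring
      | 2 => simp [F.form_vertex, e20, e21, e22, hQ]; ring
    | 2 =>
      convert hy2 using 1
      refine F.form_inj _ _ fun j => ?_
      match j with
      | 0 => simp [F.form_vertex, e00, e01, e02, hQ]; ring
      | 1 => simp [F.form_vertex, e10, e11, e12, hQ]; ring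
      | 2 => simp [F.form_vertex, e20, e21, e22, hQ]; ring
  rw [le_div_iff₀ hR]
  calc d * (1 - d) * R ≤ Q * R := mul_le_mul_of_nonneg_right hQd hR.le
    _ = R * Q := mul_comm _ _
    _ ≤ _ := hr'

end CenteredFrame

/-! ### Polygons realising all admissible values. -/

namespace CenteredFrame

variable {S : Set (EuclideanSpace ℝ (Fin 2))}

/-- A polygon given in barycentric coordinates yields a convex body, scaled by `R`, whose radii and
minimum diameter can be read off from the polygon. -/
theorem exists_convexBody_of_polygon (F : CenteredFrame S) {R d ρ : ℝ} (hR : 0 < R) (hd : 0 < d)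
    (hρ : 0 ≤ ρ) {P : Set (Fin 3 → ℝ)} (hPconv : Convex ℝ P) (hPclosed : IsClosed P)
    (hPnn : ∀ u ∈ P, ∀ i, 0 ≤ u i) (hPle : ∀ u ∈ P, ∀ i, u i ≤ d)
    (htouch : ∀ i, ∃ u ∈ P, u 0 + u 1 + u 2 = 1 ∧ u i = 0)
    (hmax : ∃ i, ∃ u ∈ P, u 0 + u 1 + u 2 = 1 ∧ u i = d)
    (hin : ∃ τ : Fin 3 → ℝ, τ 0 + τ 1 + τ 2 = 1 - ρ ∧ ∀ i, τ + Pi.single i ρ ∈ P)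
    (hout : ∀ σ, ∀ τ : Fin 3 → ℝ, τ 0 + τ 1 + τ 2 = 1 - σ → (∀ i, τ + Pi.single i σ ∈ P) →
      σ ≤ ρ) :
    ∃ K : ConvexBody (EuclideanSpace ℝ (Fin 2)), (K : Set (EuclideanSpace ℝ (Fin 2))).Nontrivial ∧
      inradius (K : Set (EuclideanSpace ℝ (Fin 2))) S = R * ρ ∧
      circumradius (K : Set (EuclideanSpace ℝ (Fin 2))) S = R ∧
      minDiameter (K : Set (EuclideanSpace ℝ (Fin 2))) S = 3 * R * d := by
  let u : EuclideanSpace ℝ (Fin 2) → Fin 3 → ℝ := fun x i => F.form i x / R + 1 / 3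
  have hu : ∀ x i, F.form i x = R * (u x i - 1 / 3) := by
    intro x i; simp only [u]; field_simp; ring
  have husum : ∀ x, u x 0 + u x 1 + u x 2 = 1 := by
    intro x
    have := F.sum_form x
    rw [hu, hu, hu, ← mul_add, ← mul_add] at this
    rcases mul_eq_zero.1 this with h | h <;> linarith
  have hex : ∀ v : Fin 3 → ℝ, v 0 + v 1 + v 2 = 1 → ∃ x, u x = v := by
    intro v hv
    obtain ⟨x, hx⟩ := F.exists_form_eq (fun i => R * (v i - 1 / 3)) (by
      rw [← mul_add, ← mul_add]; exact mul_eq_zero_of_right _ (by linarith))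
    refine ⟨x, funext fun i => ?_⟩
    simp only [u, hx]; field_simp; ring
  have hucont : Continuous u := by
    refine continuous_pi fun i => ?_
    exact ((F.form i).continuous_of_finiteDimensional.div_const R).add_const _
  -- The image of `u` is the plane of coordinate sum `1`, so only that slice of `P` matters.
  set K := u ⁻¹' P with hKdef
  have hKconv : Convex ℝ K := by
    intro x hx y hy a b ha hb hab
    have : u (a • x + b • y) = a • u x + b • u y := by
      funext i
      simp only [u, map_add, map_smul, Pi.add_apply, Pi.smul_apply, smul_eq_mul]
      linear_combination (-(1 / 3) : ℝ) * hab
    rw [hKdef, Set.mem_preimage, this]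
    exact hPconv hx hy ha hb hab
  have hKsub : K ⊆ R • S := by
    intro x hx
    refine ⟨R⁻¹ • x, (F.mem_iff _).2 fun i => ?_, by simp [smul_smul, hR.ne']⟩
    have := hPnn _ hx i
    simp only [u] at this
    rw [map_smul, smul_eq_mul, inv_mul_eq_div]
    linarith
  have hKcomp : IsCompact K :=
    (F.isCompact.smul R).of_isClosed_subset (hPclosed.preimage hucont) hKsub
  obtain ⟨i₀, v, hvP, hv1, hvd⟩ := hmax
  obtain ⟨z, hz⟩ := hex v hv1
  have hzK : z ∈ K := by rw [hKdef, Set.mem_preimage, hz]; exact hvP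
  have hmem : ∀ i, ∃ x ∈ K, u x i = 0 := by
    intro i
    obtain ⟨v, hvP, hv1, hv0⟩ := htouch i
    obtain ⟨x, hx⟩ := hex v hv1
    exact ⟨x, by rw [hKdef, Set.mem_preimage, hx]; exact hvP, by rw [hx, hv0]⟩
  have hm : ∀ i, IsLeast (F.form i '' K) (-(R / 3)) := by
    intro i
    obtain ⟨x, hxK, hx0⟩ := hmem i
    refine ⟨⟨x, hxK, by rw [hu, hx0]; ring⟩, ?_⟩
    rintro _ ⟨y, hy, rfl⟩
    have := mul_nonneg hR.le (hPnn _ hy i)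
    rw [hu]; linarith
  have hcirc : circumradius K S = R := by rw [F.circumradius_eq hm]; ring
  have hhom : ∀ t σ i, u (t + (R * σ) • F.vertex i) = (fun j => u t j - σ / 3) + Pi.single i σ := by
    intro t σ i
    funext j
    simp only [u, map_add, map_smul, F.form_vertex, Pi.add_apply, smul_eq_mul, Pi.single_apply]
    split_ifs <;> field_simp <;> ring
  refine ⟨⟨K, hKconv, hKcomp, ⟨z, hzK⟩⟩, ?_, ?_, hcirc, ?_⟩
  · obtain ⟨x, hxK, hx0⟩ := hmem i₀
    refine ⟨x, hxK, z, hzK, ?_⟩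
    rintro rfl
    rw [hz, hvd] at hx0
    exact hd.ne' hx0
  · refine le_antisymm (csSup_le ⟨0, le_rfl, z, ?_⟩ ?_) ?_
    · exact (F.homothet_subset_iff hKconv z 0).2 fun i => by simpa using hzK
    · rintro r ⟨hr, t, ht⟩
      have ht' := (F.homothet_subset_iff hKconv t r).1 ht
      have hrR : r = R * (r / R) := by field_simp
      rw [hrR] at ht' ⊢
      refine mul_le_mul_of_nonneg_left (hout _ (fun j => u t j - r / R / 3) ?_ fun i => ?_) hR.le
      · linarith [husum t]
      · rw [← hhom]; exact ht' i
    · obtain ⟨τ, hτ, hτP⟩ := hin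
      obtain ⟨t, ht⟩ := hex (fun j => τ j + ρ / 3) (by linarith)
      refine F.le_inradius hKconv hm (by positivity) (t := t) fun i => ?_
      rw [hKdef, Set.mem_preimage, hhom, ht]
      simpa using hτP i
  · refine le_antisymm (minDiameter_le (by positivity) fun x hx y hy => ?_) ?_
    · refine F.gauge_le (by positivity) fun i => ?_
      have h1 := mul_nonneg hR.le (hPnn _ hx i)
      have h2 := mul_le_mul_of_nonneg_left (hPle _ hy i) hR.le
      rw [map_sub, hu, hu]
      linarith
    · have := F.width_le_minDiameter hm i₀ hzK
      rw [hu, hz, hvd] at this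
      change 3 * R * d ≤ minDiameter K S
      linarith

/-- The simplex is truncated at height `d`, cut along the line through the contact points `(1-d, 0,
d)` and `(d, 1-d, 0)`, and cut again by `u 1 ≤ α` to tune the inradius to `d * α`. -/
theorem exists_convexBody_of_ratio_le (F : CenteredFrame S) {R d ρ : ℝ} (hR : 0 < R)
    (hd : 1 / 2 ≤ d) (hd1 : d ≤ 1) (hρ : d * (1 - d) ≤ ρ) (hρ' : ρ ≤ d ^ 2) :
    ∃ K : ConvexBody (EuclideanSpace ℝ (Fin 2)), (K : Set (EuclideanSpace ℝ (Fin 2))).Nontrivial ∧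
      inradius (K : Set (EuclideanSpace ℝ (Fin 2))) S = R * ρ ∧
      circumradius (K : Set (EuclideanSpace ℝ (Fin 2))) S = R ∧
      minDiameter (K : Set (EuclideanSpace ℝ (Fin 2))) S = 3 * R * d := by
  have hd0 : 0 < d := by linarith
  obtain ⟨α, rfl⟩ : ∃ α, ρ = d * α := ⟨ρ / d, by field_simp⟩
  have hα : 1 - d ≤ α := le_of_mul_le_mul_left hρ hd0
  have hα' : α ≤ d := le_of_mul_le_mul_left (by rwa [sq] at hρ') hd0
  have h1d : 0 ≤ 1 - d := by linarith
  have hα0 : 0 ≤ α := h1d.trans hα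
  refine F.exists_convexBody_of_polygon hR hd0 (by positivity)
    (P := {u | (∀ i, 0 ≤ u i) ∧ (∀ i, u i ≤ d) ∧ u 1 ≤ α ∧
      0 ≤ -(d * (1 - d)) * u 0 + d ^ 2 * u 1 + (1 - d) ^ 2 * u 2}) ?_ ?_
    (fun u hu => hu.1) (fun u hu => hu.2.1) ?_ ?_ ?_ ?_
  · rintro u ⟨hu0, hu1, hu2, hu3⟩ v ⟨hv0, hv1, hv2, hv3⟩ a b ha hb hab
    have hb' : b = 1 - a := by linarith
    refine ⟨fun i => ?_, fun i => ?_, ?_, ?_⟩ <;>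
      simp only [Pi.add_apply, Pi.smul_apply, smul_eq_mul]
    · have := mul_nonneg ha (hu0 i); have := mul_nonneg hb (hv0 i); linarith
    · have := mul_le_mul_of_nonneg_left (hu1 i) ha
      have := mul_le_mul_of_nonneg_left (hv1 i) hb
      subst hb'; linarith
    · have := mul_le_mul_of_nonneg_left hu2 ha
      have := mul_le_mul_of_nonneg_left hv2 hb
      subst hb'; linarith
    · have := mul_nonneg ha hu3; have := mul_nonneg hb hv3; linarith
  · simp only [Set.ofPred_and, Set.ofPred_forall]
    refine (isClosed_iInter fun i => isClosed_le (by fun_prop) (by fun_prop)).inter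
      ((isClosed_iInter fun i => isClosed_le (by fun_prop) (by fun_prop)).inter
      ((isClosed_le (by fun_prop) (by fun_prop)).inter (isClosed_le (by fun_prop) (by fun_prop))))
  · intro i
    match i with
    | 0 =>
      refine ⟨![0, 1 - d, d], ⟨?_, ?_, ?_, ?_⟩, ?_, ?_⟩ <;>
        simp [Fin.forall_fin_succ] <;> first | positivity | (refine ⟨?_, ?_⟩ <;> linarith) | linarith
    | 1 =>
      refine ⟨![1 - d, 0, d], ⟨?_, ?_, ?_, ?_⟩, ?_, ?_⟩ <;>
        simp [Fin.forall_fin_succ] <;> first | (refine ⟨?_, ?_⟩ <;> linarith) | linarith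
    | 2 =>
      refine ⟨![d, 1 - d, 0], ⟨?_, ?_, ?_, ?_⟩, ?_, ?_⟩ <;>
        simp [Fin.forall_fin_succ] <;> first | (refine ⟨?_, ?_⟩ <;> linarith) | linarith
  · refine ⟨0, ![d, 1 - d, 0], ⟨?_, ?_, ?_, ?_⟩, ?_, ?_⟩ <;>
      simp [Fin.forall_fin_succ] <;> first | (refine ⟨?_, ?_⟩ <;> linarith) | linarith
  · have h1 : 0 ≤ (1 - d) * (1 - α) := mul_nonneg h1d (by linarith)
    have h2 : 0 ≤ α * (1 - d) := mul_nonneg hα0 h1d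
    have h3 : 0 ≤ d * (1 - α) := mul_nonneg hd0.le (by linarith)
    have h4 : 0 ≤ d * α := mul_nonneg hd0.le hα0
    have h5 : 0 ≤ (2 * d - 1) * (1 - α) := mul_nonneg (by linarith) (by linarith)
    -- This translate makes the constraints `u 1 ≤ α`, `u 2 ≤ d` and the slanted cut tight.
    refine ⟨![(1 - d) * (1 - α), α * (1 - d), d * (1 - α)], by simp; ring, fun i => ?_⟩
    match i with
    | 0 =>
      refine ⟨?_, ?_, ?_, ?_⟩ <;> simp [Fin.forall_fin_succ, Pi.single_apply] <;>
        first | (refine ⟨?_, ?_, ?_⟩ <;> nlinarith) | nlinarith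
    | 1 =>
      refine ⟨?_, ?_, ?_, ?_⟩ <;> simp [Fin.forall_fin_succ, Pi.single_apply] <;>
        first | (refine ⟨?_, ?_, ?_⟩ <;> nlinarith) | nlinarith
    | 2 =>
      refine ⟨?_, ?_, ?_, ?_⟩ <;> simp [Fin.forall_fin_succ, Pi.single_apply] <;>
        first | (refine ⟨?_, ?_, ?_⟩ <;> nlinarith) | nlinarith
  · intro σ τ hτ h
    have h0 := (h 0).2.2.2
    have h1 := (h 1).2.2.1
    have h2 := (h 2).2.1 2
    simp at h0 h1 h2
    have e : τ 0 = 1 - σ - τ 1 - τ 2 := by linarith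
    rw [e] at h0
    -- With the coordinate sum eliminated, the slanted cut reads `d(1-d) ≤ d * τ 1 + (1-d) * τ 2`;
    -- weighting the other two bounds by `d` and `1 - d` leaves `σ ≤ d * α`.
    have h1' := mul_le_mul_of_nonneg_left h1 hd0.le
    have h2' := mul_le_mul_of_nonneg_left h2 h1d
    linarith

/-- Only upper bounds on the coordinates are needed here. An inscribed homothet of ratio `σ`
satisfies the sum of the three bounds, `1 + 2σ ≤ 2d + (2ρ + 1 - 2d)`, which caps `σ` at `ρ`. -/
theorem exists_convexBody_of_le_ratio (F : CenteredFrame S) {R d ρ : ℝ} (hR : 0 < R)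
    (hd : 1 / 2 ≤ d) (hρ : d ^ 2 ≤ ρ) (hρ' : 2 * ρ + 1 ≤ 3 * d) :
    ∃ K : ConvexBody (EuclideanSpace ℝ (Fin 2)), (K : Set (EuclideanSpace ℝ (Fin 2))).Nontrivial ∧
      inradius (K : Set (EuclideanSpace ℝ (Fin 2))) S = R * ρ ∧
      circumradius (K : Set (EuclideanSpace ℝ (Fin 2))) S = R ∧
      minDiameter (K : Set (EuclideanSpace ℝ (Fin 2))) S = 3 * R * d := by
  have hd0 : 0 < d := by linarith
  have hρ0 : 0 ≤ ρ := (sq_nonneg d).trans hρ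
  have hd1 : d ≤ 1 := by nlinarith
  -- Equivalent to `1 - d ≤ 2ρ + 1 - 2d`: the contact points with `u 0 = 1 - d` survive the cut.
  have hγ : d ≤ 2 * ρ := by nlinarith
  have hτ : 2 * d ≤ ρ + 1 := by nlinarith [sq_nonneg (d - 1)]
  have hγd : 2 * ρ + 1 - 2 * d ≤ d := by linarith
  have hρd : ρ ≤ d := by linarith
  refine F.exists_convexBody_of_polygon hR hd0 hρ0
    (P := {u | (∀ i, 0 ≤ u i) ∧ (∀ i, u i ≤ d) ∧ u 0 ≤ 2 * ρ + 1 - 2 * d}) ?_ ?_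
    (fun u hu => hu.1) (fun u hu => hu.2.1) ?_ ?_ ?_ ?_
  · rintro u ⟨hu0, hu1, hu2⟩ v ⟨hv0, hv1, hv2⟩ a b ha hb hab
    have hb' : b = 1 - a := by linarith
    refine ⟨fun i => ?_, fun i => ?_, ?_⟩ <;>
      simp only [Pi.add_apply, Pi.smul_apply, smul_eq_mul]
    · have := mul_nonneg ha (hu0 i); have := mul_nonneg hb (hv0 i); linarith
    · have := mul_le_mul_of_nonneg_left (hu1 i) ha
      have := mul_le_mul_of_nonneg_left (hv1 i) hb
      subst hb'; linarith
    · have := mul_le_mul_of_nonneg_left hu2 ha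
      have := mul_le_mul_of_nonneg_left hv2 hb
      subst hb'; linarith
  · simp only [Set.ofPred_and, Set.ofPred_forall]
    refine (isClosed_iInter fun i => isClosed_le (by fun_prop) (by fun_prop)).inter
      ((isClosed_iInter fun i => isClosed_le (by fun_prop) (by fun_prop)).inter
      (isClosed_le (by fun_prop) (by fun_prop)))
  · intro i
    match i with
    | 0 =>
      refine ⟨![0, 1 - d, d], ⟨?_, ?_, ?_⟩, ?_, ?_⟩ <;>
        simp [Fin.forall_fin_succ] <;> first | (refine ⟨?_, ?_⟩ <;> linarith) | linarith
    | 1 =>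
      refine ⟨![1 - d, 0, d], ⟨?_, ?_, ?_⟩, ?_, ?_⟩ <;>
        simp [Fin.forall_fin_succ] <;> first | (refine ⟨?_, ?_⟩ <;> linarith) | linarith
    | 2 =>
      refine ⟨![1 - d, d, 0], ⟨?_, ?_, ?_⟩, ?_, ?_⟩ <;>
        simp [Fin.forall_fin_succ] <;> first | (refine ⟨?_, ?_⟩ <;> linarith) | linarith
  · refine ⟨2, ![0, 1 - d, d], ⟨?_, ?_, ?_⟩, ?_, ?_⟩ <;>
      simp [Fin.forall_fin_succ] <;> first | (refine ⟨?_, ?_⟩ <;> linarith) | linarith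
  · refine ⟨![ρ + 1 - 2 * d, d - ρ, d - ρ], by simp; ring, fun i => ?_⟩
    match i with
    | 0 =>
      refine ⟨?_, ?_, ?_⟩ <;> simp [Fin.forall_fin_succ, Pi.single_apply] <;>
        first | (refine ⟨?_, ?_⟩ <;> linarith) | linarith
    | 1 =>
      refine ⟨?_, ?_, ?_⟩ <;> simp [Fin.forall_fin_succ, Pi.single_apply] <;>
        first | (refine ⟨?_, ?_⟩ <;> linarith) | (refine ⟨?_, ?_, ?_⟩ <;> linarith) | linarith
    | 2 =>
      refine ⟨?_, ?_, ?_⟩ <;> simp [Fin.forall_fin_succ, Pi.single_apply] <;>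
        first | (refine ⟨?_, ?_⟩ <;> linarith) | (refine ⟨?_, ?_, ?_⟩ <;> linarith) | linarith
  · intro σ τ hτ h
    have h0 := (h 0).2.2
    have h1 := (h 1).2.1 1
    have h2 := (h 2).2.1 2
    simp at h0 h1 h2
    linarith

theorem exists_isLeast_form (F : CenteredFrame S) (K : ConvexBody (EuclideanSpace ℝ (Fin 2))) :
    ∃ m : Fin 3 → ℝ, ∀ i, IsLeast (F.form i '' (K : Set (EuclideanSpace ℝ (Fin 2)))) (m i) := by
  have h : ∀ i, ∃ c, IsLeast (F.form i '' (K : Set (EuclideanSpace ℝ (Fin 2)))) c := fun i =>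
    (K.isCompact.image (F.form i).continuous_of_finiteDimensional).exists_isLeast
      (K.nonempty.image _)
  choose m hm using h
  exact ⟨m, hm⟩

theorem exists_convexBody_iff (F : CenteredFrame S) {r R D : ℝ} (hR : 0 < R) (hD : 0 ≤ D) :
    (∃ K : ConvexBody (EuclideanSpace ℝ (Fin 2)),
      (K : Set (EuclideanSpace ℝ (Fin 2))).Nontrivial ∧
      inradius (K : Set (EuclideanSpace ℝ (Fin 2))) S = r ∧
      circumradius (K : Set (EuclideanSpace ℝ (Fin 2))) S = R ∧
      minDiameter (K : Set (EuclideanSpace ℝ (Fin 2))) S = D) ↔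
    (D ≤ 3 * R ∧ 2 * r + R ≤ D ∧ (D / (3 * R)) * (1 - D / (3 * R)) ≤ r / R) := by
  constructor
  · rintro ⟨K, -, rfl, rfl, rfl⟩
    obtain ⟨m, hm⟩ := F.exists_isLeast_form K
    exact ⟨F.minDiameter_le_three_mul_circumradius hm,
      F.two_mul_inradius_add_circumradius_le K.convex hm, F.inradius_lower_bound K.convex hm hR⟩
  · rintro ⟨h1, h2, h3⟩
    obtain ⟨d, rfl⟩ : ∃ d, D = 3 * R * d := ⟨D / (3 * R), by field_simp⟩
    obtain ⟨ρ, rfl⟩ : ∃ ρ, r = R * ρ := ⟨r / R, by field_simp⟩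
    rw [mul_div_cancel_left₀ _ (by positivity : 3 * R ≠ 0), mul_div_cancel_left₀ _ hR.ne'] at h3
    have hd1 : d ≤ 1 := le_of_mul_le_mul_left (by linarith : R * d ≤ R * 1) hR
    have h2' : 2 * ρ + 1 ≤ 3 * d :=
      le_of_mul_le_mul_left (by linarith : R * (2 * ρ + 1) ≤ R * (3 * d)) hR
    have hd0 : 0 ≤ d := nonneg_of_mul_nonneg_right hD (by positivity)
    -- The two bounds on `ρ` combine to `(2d - 1)(d + 1) ≥ 0`.
    have hd : 1 / 2 ≤ d := by nlinarith
    rcases le_total ρ (d ^ 2) with h | h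
    · exact F.exists_convexBody_of_ratio_le hR hd hd1 h3 h
    · exact F.exists_convexBody_of_le_ratio hR hd h h2'

end CenteredFrame

theorem inradius_nonneg {n : ℕ} (K C : Set (EuclideanSpace ℝ (Fin n))) : 0 ≤ inradius K C :=
  Real.sSup_nonneg fun _ h => h.1

theorem mainTheorem6 (S : Set (EuclideanSpace ℝ (Fin 2))) (hS : IsTriangle S)
    (hcent : MinkowskiCentered S) :
    (minDiagram S = {p : ℝ × ℝ | 0 ≤ p.1 ∧ 0 ≤ p.2 ∧
        p.2 ≤ 3 / 2 ∧
        2 * p.1 + 1 ≤ 2 * p.2 ∧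
        (2 * p.2 / 3) * (1 - 2 * p.2 / 3) ≤ p.1}) ∧
    (∀ r R D : ℝ, 0 ≤ r → 0 < R → 0 ≤ D →
      ((∃ K : ConvexBody (EuclideanSpace ℝ (Fin 2)),
          (K : Set (EuclideanSpace ℝ (Fin 2))).Nontrivial ∧
          inradius (K : Set (EuclideanSpace ℝ (Fin 2))) S = r ∧
          circumradius (K : Set (EuclideanSpace ℝ (Fin 2))) S = R ∧
          minDiameter (K : Set (EuclideanSpace ℝ (Fin 2))) S = D) ↔
        (D ≤ 3 * R ∧
          2 * r + R ≤ D ∧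
          (D / (3 * R)) * (1 - D / (3 * R)) ≤ r / R))) := by
  obtain ⟨F⟩ := MinkowskiCentered.exists_frame hS hcent
  refine ⟨?_, fun r R D _ hR hD => CenteredFrame.exists_convexBody_iff F hR hD⟩
  ext ⟨x, y⟩
  constructor
  · rintro ⟨K, hK, hp⟩
    obtain ⟨m, hm⟩ := CenteredFrame.exists_isLeast_form F K
    have hR := CenteredFrame.circumradius_pos F hK hm
    have hr := inradius_nonneg (K : Set (EuclideanSpace ℝ (Fin 2))) S
    have h2 := CenteredFrame.two_mul_inradius_add_circumradius_le F K.convex hm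
    obtain ⟨h1, -, h3⟩ := (CenteredFrame.exists_convexBody_iff F hR (by linarith)).1
      ⟨K, hK, rfl, rfl, rfl⟩
    obtain ⟨rfl, rfl⟩ := Prod.mk.inj hp
    set R := circumradius (K : Set (EuclideanSpace ℝ (Fin 2))) S
    set r := inradius (K : Set (EuclideanSpace ℝ (Fin 2))) S
    set D := minDiameter (K : Set (EuclideanSpace ℝ (Fin 2))) S
    have e : 2 * (D / (2 * R)) / 3 = D / (3 * R) := by field_simp
    refine ⟨by positivity, div_nonneg (by linarith) (by linarith), ?_, ?_, ?_⟩
    · show D / (2 * R) ≤ 3 / 2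
      rw [div_le_div_iff₀ (by linarith) (by norm_num)]
      linarith
    · show 2 * (r / R) + 1 ≤ 2 * (D / (2 * R))
      have e1 : 2 * (r / R) + 1 = (2 * r + R) / R := by field_simp
      have e2 : 2 * (D / (2 * R)) = D / R := by field_simp
      rw [e1, e2]
      exact div_le_div_of_nonneg_right h2 hR.le
    · show 2 * (D / (2 * R)) / 3 * (1 - 2 * (D / (2 * R)) / 3) ≤ r / R
      rwa [e]
  · rintro ⟨-, h0, h1, h2, h3⟩
    simp only at h0 h1 h2 h3
    obtain ⟨K, hK, hr, hR, hD⟩ := (CenteredFrame.exists_convexBody_iff F (r := x) (R := 1)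
      (D := 2 * y) one_pos (by linarith)).2 ⟨by linarith, by linarith, by simpa using h3⟩
    refine ⟨K, hK, ?_⟩
    rw [hr, hR, hD]
    simp
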